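/- There is a sequence of undirected unweighted graphs $G_1, G_2, \dots$, where $G_n$ has $n$ vertices, such that every (possibly weighted) emulator of $G_n$ with $O(n)$ edges has additive stretch $\Omega(n^{2/29})$. That is, for every $C>0$ there are $c>0$ and $N\in\mathbb{N}$ such that for every $n\ge N$, every undirected graph $H$ on the vertex set $V(G_n)$ with nonnegative real edge weights and with at most $Cn$ edges, and every real $\beta\ge 0$ the following holds: if $$\mathrm{dist}_{G_n}(u,v)\le \mathrm{dist}_H(u,v)\le \mathrm{dist}_{G_n}(u,v)+\beta\qquad\text{for all } u,v\in V(G_n)$$ (that is, if $H$ is an emulator of $G_n$ with additive stretch $\beta$), then $\beta\ge c\,n^{2/29}$. Here $\mathrm{dist}_{G_n}$ is the hop distance, $\mathrm{dist}_H$ is the weighted shortest-path distance, and the distance between vertices in different connected components is $\infty$. -/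

import Mathlib

open scoped NNReal ENNReal

/-- A finite or infinite undirected simple graph on the vertex set `V` with nonnegative real edge
weights. Only the values of `weight` on the edges of the graph are ever used. -/
structure WeightedGraph (V : Type*) where
  /-- the underlying undirected graph -/
  graph : SimpleGraph V
  /-- the weight of each edge -/
  weight : Sym2 V → ℝ≥0

namespace WeightedGraph

variable {V : Type*}

/-- The total weight of a walk: the sum of the weights of its edges, with multiplicity. -/
def walkWeight (H : WeightedGraph V) {u v : V} (p : H.graph.Walk u v) : ℝ≥0 :=
  (p.edges.map H.weight).sum

/-- The weighted distance: the infimum of the weights of the walks from `u` to `v`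
(`∞` if there is no such walk). -/
noncomputable def edist (H : WeightedGraph V) (u v : V) : ℝ≥0∞ :=
  ⨅ p : H.graph.Walk u v, (H.walkWeight p : ℝ≥0∞)

/-- `H` is an emulator of the unweighted graph `G` with additive stretch (at most) `β`:
`dist_G(u,v) ≤ dist_H(u,v) ≤ dist_G(u,v) + β` for all vertices `u, v`, where distances between
different connected components are `∞`. The graph `H` need not be a subgraph of `G`. -/
def IsEmulator (H : WeightedGraph V) (G : SimpleGraph V) (β : ℝ≥0) : Prop :=
  ∀ u v : V, (G.edist u v : ℝ≥0∞) ≤ H.edist u v ∧ H.edist u v ≤ (G.edist u v : ℝ≥0∞) + β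

end WeightedGraph

/-!
The lower bound comes from an obstacle product. The outer graph has the junctions `ℤ³ × {0, 1}` as
vertices; steps from type `0` to type `1` are `(i, 0, 2k² - i²)` and steps from type `1` to type `0`
are `(0, j, 2k² - j²)`, with `0 ≤ i, j < k`. By strict concavity, a walk that always uses the same
`i` and the same `j` is the unique shortest walk between its ends, backward steps included
(`Steps.eq_iterate_of_add_le`), and two such walks share at most one edge (`labels_unique`). Each
junction is replaced by a biclique between `k` ports for one kind of step and `k` ports for the
other, and each outer edge by a path of length `8m - 1`.

A route is a straight walk of `2m` steps. It crosses one biclique edge per step, and any way round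
that edge within the biclique costs `2` more. If an emulator has stretch less than `2m`, a light
walk between the ends of a route stays near the route, since otherwise it would use additional outer
edges or climb too high on an arm beside the route (`exists_near`). It cannot bypass all biclique
edges of the route, as this would cost `4m` extra; hence one of its edges replaces a piece of the
route that includes such a biclique edge. The potential `progress` makes this precise: a pair of
sites near the route whose distance is less than the difference of `progress` is of one of four
kinds (`progress_sub_le`), and in each kind the pair determines the route (`Charged.eq`). So the
number of routes is at most eight times the number of edges of the emulator (`card_le_edges`).

In a suitable box there are `864 m⁴k⁵` vertices and `2 m²k⁶` routes. With `m = q¹⁰` and `k = q²¹`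
these numbers are of order `q¹⁴⁵` and `q¹⁴⁶`, so linearly many edges do not suffice once `q` is
large, and the stretch is at least `2 q¹⁰`, which is of order `n ^ (10 / 145) = n ^ (2 / 29)`.
-/

namespace ObstacleProduct

variable {m k : ℤ} {lab lab' : Bool → ℤ}

/-! ### Junctions, their displacements, and uniqueness of straight walks -/

/-- A vertex of the outer graph: a lattice point together with one of two types. The outer graph is
bipartite, with the types as parts. -/
structure Junction where
  x : ℤ
  y : ℤ
  z : ℤ
  c : Bool

/-- The far end of the outer edge that leaves `v` by the arm of side `s` and label `d`. The arms of
side `false` have displacement `(d, 0, 2 k² - d²)`, those of side `true` have `(0, d, 2 k² - d²)`.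
An arm is traversed forwards from the junction whose type equals its side, and backwards from the
other one. Labels are meant to lie in `[0, k)`; the box of the finite graph plays no role here. -/
def across (k : ℤ) (v : Junction) (s : Bool) (d : ℤ) : Junction :=
  if s = v.c then
    ⟨v.x + (if s then 0 else d), v.y + (if s then d else 0), v.z + (2 * k ^ 2 - d ^ 2), !v.c⟩
  else
    ⟨v.x - (if s then 0 else d), v.y - (if s then d else 0), v.z - (2 * k ^ 2 - d ^ 2), !v.c⟩

theorem across_c (v : Junction) (s : Bool) (d : ℤ) : (across k v s d).c = !v.c := by
  unfold across; split <;> rfl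

theorem across_ne (v : Junction) (s : Bool) (d : ℤ) : across k v s d ≠ v := by
  intro h
  have := congrArg Junction.c h
  simp [across_c] at this

theorem across_across (v : Junction) (s : Bool) (d : ℤ) :
    across k (across k v s d) s d = v := by
  rcases v with ⟨x, y, z, c⟩
  cases s <;> cases c <;> simp [across]

theorem across_injective {v : Junction} {s s' : Bool} {d d' : ℤ} (hd : 0 ≤ d) (hdk : d < k)
    (hd' : 0 ≤ d') (hdk' : d' < k) (h : across k v s d = across k v s' d') : s = s' ∧ d = d' := by
  have h1 : d ^ 2 < k ^ 2 := by nlinarith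
  have h2 : d' ^ 2 < k ^ 2 := by nlinarith
  rcases v with ⟨x, y, z, c⟩
  cases s <;> cases s' <;> cases c <;> simp [across] at h ⊢ <;>
    first | omega | (exfalso; nlinarith [h.2.2])

/-- One step of the straight walk with labels `lab`, where `lab s` is the label used on side `s`. -/
def adv (k : ℤ) (lab : Bool → ℤ) (v : Junction) : Junction := across k v v.c (lab v.c)

/-- A functional under which the steps `adv k lab` are the unique steepest ones. It is
`2 (2 i x + 2 j y + z)` with `i = lab false` and `j = lab true`, corrected on one of the two types
so that the two kinds of forward step gain the same amount. A forward step on side `s` with the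
label `d` instead of `lab s` falls short by `2 (lab s - d)²`. -/
def energy (lab : Bool → ℤ) (v : Junction) : ℤ :=
  2 * (2 * lab false * v.x + 2 * lab true * v.y + v.z) -
    if v.c then lab false ^ 2 - lab true ^ 2 else 0

/-- The increase of `energy lab` in a step `adv k lab`. -/
def gain (k : ℤ) (lab : Bool → ℤ) : ℤ := 4 * k ^ 2 + lab false ^ 2 + lab true ^ 2

theorem energy_adv (v : Junction) : energy lab (adv k lab v) = energy lab v + gain k lab := by
  rcases v with ⟨x, y, z, c⟩
  cases c <;> simp [energy, adv, across, gain] <;> ring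

theorem energy_iterate_adv (n : ℕ) (v : Junction) :
    energy lab ((adv k lab)^[n] v) = energy lab v + n * gain k lab := by
  induction n with
  | zero => simp
  | succ n ih =>
    rw [Function.iterate_succ_apply', energy_adv, ih]; push_cast; ring

theorem energy_across_le (hlab : ∀ b, 0 ≤ lab b ∧ lab b < k) {d : ℤ} (hd : 0 ≤ d) (hdk : d < k)
    (v : Junction) (s : Bool) :
    energy lab (across k v s d) ≤ energy lab v + gain k lab ∧
      (energy lab (across k v s d) = energy lab v + gain k lab →
        across k v s d = adv k lab v) := by
  have h0 := hlab false
  have h1 := hlab true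
  have hk : 0 < k := by omega
  have key : ∀ b, (lab b - d) ^ 2 < k ^ 2 := fun b => by
    have := hlab b
    exact sq_lt_sq' (by omega) (by omega)
  have k0 := key false
  have k1 := key true
  rcases v with ⟨x, y, z, c⟩
  have hz : ∀ a : ℤ, (a - d) ^ 2 ≤ 0 → d = a := fun a ha => by
    have : a - d = 0 := by
      have := le_antisymm ha (sq_nonneg _)
      exact pow_eq_zero_iff two_ne_zero |>.1 this
    omega
  cases s <;> cases c
  · refine ⟨?_, fun h => ?_⟩
    · simp [energy, across, gain]; nlinarith [sq_nonneg (lab false - d)]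
    · have : d = lab false := hz _ (by simp [energy, across, gain] at h; nlinarith)
      simp [adv, this]
  · refine ⟨?_, fun h => ?_⟩
    · simp [energy, across, gain]; nlinarith [sq_nonneg (lab false - d)]
    · exfalso; simp [energy, across, gain] at h
      nlinarith [sq_nonneg (lab false), sq_nonneg (lab true)]
  · refine ⟨?_, fun h => ?_⟩
    · simp [energy, across, gain]; nlinarith [sq_nonneg (lab true - d)]
    · exfalso; simp [energy, across, gain] at h
      nlinarith [sq_nonneg (lab false), sq_nonneg (lab true)]
  · refine ⟨?_, fun h => ?_⟩
    · simp [energy, across, gain]; nlinarith [sq_nonneg (lab true - d)]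
    · have : d = lab true := hz _ (by simp [energy, across, gain] at h; nlinarith)
      simp [adv, this]

/-- `Steps k n v w`: the outer graph, on all of `ℤ³ × Bool`, has a walk of length `n` from `v`
to `w`. -/
inductive Steps (k : ℤ) : ℕ → Junction → Junction → Prop
  | refl (v : Junction) : Steps k 0 v v
  | step {n : ℕ} {v w : Junction} (s : Bool) {d : ℤ} (h : Steps k n v w) (hd : 0 ≤ d)
      (hdk : d < k) : Steps k (n + 1) v (across k w s d)

theorem Steps.iterate_adv (hlab : ∀ b, 0 ≤ lab b ∧ lab b < k) (n : ℕ) (v : Junction) :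
    Steps k n v ((adv k lab)^[n] v) := by
  induction n with
  | zero => exact .refl v
  | succ n ih =>
    rw [Function.iterate_succ_apply']
    exact .step _ ih (hlab _).1 (hlab _).2

theorem Steps.energy_le (hlab : ∀ b, 0 ≤ lab b ∧ lab b < k) {n : ℕ} {v w : Junction}
    (h : Steps k n v w) :
    energy lab w ≤ energy lab v + n * gain k lab ∧
      (energy lab w = energy lab v + n * gain k lab → w = (adv k lab)^[n] v) := by
  induction h with
  | refl => simp
  | @step n v w s d h hd hdk ih =>
    obtain ⟨h1, h2⟩ := energy_across_le hlab hd hdk w s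
    push_cast
    refine ⟨by linarith [ih.1], fun e => ?_⟩
    rw [h2 (by linarith [ih.1]), ih.2 (by linarith [ih.1]), Function.iterate_succ_apply']

theorem Steps.energy_le_reverse (hlab : ∀ b, 0 ≤ lab b ∧ lab b < k) {n : ℕ} {v w : Junction}
    (h : Steps k n v w) :
    energy lab v ≤ energy lab w + n * gain k lab ∧
      (energy lab v = energy lab w + n * gain k lab → v = (adv k lab)^[n] w) := by
  induction h with
  | refl => simp
  | @step n v w s d h hd hdk ih =>
    obtain ⟨h1, h2⟩ := energy_across_le hlab hd hdk (across k w s d) s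
    rw [across_across] at h1 h2
    push_cast
    refine ⟨by linarith [ih.1], fun e => ?_⟩
    rw [Function.iterate_succ_apply, ← h2 (by linarith [ih.1])]
    exact ih.2 (by linarith [ih.1])

theorem gain_pos (hlab : ∀ b, 0 ≤ lab b ∧ lab b < k) : 0 < gain k lab := by
  have := hlab false
  have : 0 < k := by omega
  unfold gain; positivity

/-- A straight walk is the only shortest walk between its ends, and each junction `w` that lies on
some walk of at most that length lies on the straight walk, at the right place. -/
theorem Steps.eq_iterate_of_add_le (hlab : ∀ b, 0 ≤ lab b ∧ lab b < k) {n a b : ℕ}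
    {v w : Junction} (ha : Steps k a v w) (hb : Steps k b ((adv k lab)^[n] v) w)
    (hab : a + b ≤ n) : a + b = n ∧ w = (adv k lab)^[a] v := by
  obtain ⟨h1, h2⟩ := ha.energy_le hlab
  have h3 := (hb.energy_le_reverse hlab).1
  rw [energy_iterate_adv] at h3
  have hg := gain_pos hlab
  have h4 : a + b = n := by
    refine le_antisymm hab ?_
    have : (n : ℤ) * gain k lab ≤ (a + b) * gain k lab := by linarith
    exact_mod_cast le_of_mul_le_mul_right this hg
  subst h4
  push_cast at h3
  exact ⟨rfl, h2 (by linarith)⟩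

theorem iterate_adv_c (n : ℕ) (v : Junction) :
    ((adv k lab)^[n] v).c = if Even n then v.c else !v.c := by
  induction n with
  | zero => simp
  | succ n ih =>
    rw [Function.iterate_succ_apply', adv, across_c, ih]
    by_cases h : Even n <;> simp [h, Nat.even_add_one]

theorem adv_injective : Function.Injective (adv k lab) := by
  intro v w h
  have hc : v.c = w.c := by simpa [adv, across_c] using congrArg Junction.c h
  unfold adv at h
  rw [← hc] at h
  rw [← across_across (k := k) v v.c (lab v.c), h, across_across]

theorem iterate_adv_bounds (hlab : ∀ b, 0 ≤ lab b ∧ lab b < k) (n : ℕ) (v : Junction) :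
    (v.x ≤ ((adv k lab)^[n] v).x ∧ ((adv k lab)^[n] v).x ≤ v.x + n * k) ∧
    (v.y ≤ ((adv k lab)^[n] v).y ∧ ((adv k lab)^[n] v).y ≤ v.y + n * k) ∧
    (v.z + n * k ^ 2 ≤ ((adv k lab)^[n] v).z ∧ ((adv k lab)^[n] v).z ≤ v.z + n * (2 * k ^ 2)) := by
  induction n with
  | zero => simp
  | succ n ih =>
    rw [Function.iterate_succ_apply']
    generalize (adv k lab)^[n] v = w at ih
    rcases w with ⟨x, y, z, c⟩
    have h0 := hlab false
    have h1 := hlab true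
    have h2 : lab false ^ 2 ≤ k ^ 2 := by nlinarith
    have h3 : lab true ^ 2 ≤ k ^ 2 := by nlinarith
    have h4 := sq_nonneg (lab true)
    have h5 := sq_nonneg (lab false)
    push_cast
    cases c <;> simp [adv, across] at ih ⊢ <;>
      refine ⟨⟨?_, ?_⟩, ⟨?_, ?_⟩, ?_, ?_⟩ <;>
      linarith [ih.1.1, ih.1.2, ih.2.1.1, ih.2.1.2, ih.2.2.1, ih.2.2.2]

/-- Straight walks with the same labels that meet have the same start, if both start in the slab
`0 ≤ z < 2 k²`: two steps raise `z` by at least the height of the slab. -/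
theorem start_unique (hlab : ∀ b, 0 ≤ lab b ∧ lab b < k) {v w : Junction} {a b : ℕ}
    (hv : 0 ≤ v.z ∧ v.z < 2 * k ^ 2) (hw : 0 ≤ w.z ∧ w.z < 2 * k ^ 2) (hc : v.c = w.c)
    (h : (adv k lab)^[a] v = (adv k lab)^[b] w) : v = w := by
  wlog hab : a ≤ b generalizing v w a b
  · exact (this hw hv hc.symm h.symm (by omega)).symm
  obtain ⟨r, rfl⟩ := Nat.exists_eq_add_of_le hab
  rw [Function.iterate_add_apply] at h
  have h' := (adv_injective.iterate a) h
  have hb := (iterate_adv_bounds hlab r w).2.2.1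
  rw [← h'] at hb
  match r with
  | 0 => simpa using h'
  -- a single step raises `z` only by `k²`, but changes the type
  | 1 =>
    have := congrArg Junction.c h'
    rw [iterate_adv_c] at this
    simp [hc] at this
  | r + 2 =>
    exfalso
    push_cast at hb
    nlinarith [sq_nonneg k, mul_nonneg (Int.natCast_nonneg r) (sq_nonneg k)]

/-- Two straight walks that share a segment of at least two steps have the same labels, even if the
segment is not known to have the same number of steps on both. -/
theorem labels_unique (hlab : ∀ b, 0 ≤ lab b ∧ lab b < k) (hlab' : ∀ b, 0 ≤ lab' b ∧ lab' b < k)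
    {v : Junction} {a b : ℕ} (ha : 2 ≤ a) (hb : 2 ≤ b)
    (h : (adv k lab)^[a] v = (adv k lab')^[b] v) : lab = lab' := by
  have hle : ∀ {l l' : Bool → ℤ}, (∀ b, 0 ≤ l b ∧ l b < k) → (∀ b, 0 ≤ l' b ∧ l' b < k) →
      ∀ {a b : ℕ}, (adv k l)^[a] v = (adv k l')^[b] v → a ≤ b := by
    intro l l' hl hl' a b h
    have h1 := ((Steps.iterate_adv hl' b v).energy_le hl).1
    rw [← h, energy_iterate_adv] at h1
    have := le_of_mul_le_mul_right (by linarith) (gain_pos hl) (b := (a : ℤ)) (c := (b : ℤ))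
    exact_mod_cast this
  -- both walks are shortest walks between the ends of the segment
  have hab : a = b := le_antisymm (hle hlab hlab' h) (hle hlab' hlab h.symm)
  subst hab
  have key : ∀ j ≤ a, (adv k lab')^[j] v = (adv k lab)^[j] v := by
    intro j hj
    have h1 := (Steps.iterate_adv hlab' j v).energy_le hlab
    have h2 := ((Steps.iterate_adv hlab' (a - j) ((adv k lab')^[j] v)).energy_le hlab).1
    rw [← Function.iterate_add_apply, Nat.sub_add_cancel hj, ← h, energy_iterate_adv] at h2
    push_cast [hj] at h2
    exact h1.2 (by linarith [h1.1])
  have e1 := key 1 (by omega)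
  have e2 := key 2 (by omega)
  simp only [Function.iterate_succ_apply', Function.iterate_zero, id] at e1 e2
  rw [e1] at e2
  have f1 := (across_injective (hlab' _).1 (hlab' _).2 (hlab _).1 (hlab _).2 e1).2
  have f2 := (across_injective (hlab' _).1 (hlab' _).2 (hlab _).1 (hlab _).2 e2).2
  simp only [adv, across_c] at f2
  funext b
  rcases Bool.eq_or_eq_not b v.c with rfl | rfl
  · exact f1.symm
  · exact f2.symm

/-! ### The graph: bicliques joined by long arms -/

/-- A vertex of the graph: the point at height `h` on the arm of side `s` and label `d` of the
junction `hub`. The point at height `0` is the port of that arm. -/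
structure Site where
  hub : Junction
  s : Bool
  d : ℤ
  h : ℤ

/-- The finitely many sites that the graph uses: arms have `4 m` points, labels lie in `[0, k)`, and
the hubs fill a box. -/
structure Site.Valid (m k : ℤ) (u : Site) : Prop where
  d_nonneg : 0 ≤ u.d
  d_lt : u.d < k
  h_nonneg : 0 ≤ u.h
  h_lt : u.h < 4 * m
  x_nonneg : 0 ≤ u.hub.x
  x_lt : u.hub.x < 3 * m * k
  y_nonneg : 0 ≤ u.hub.y
  y_lt : u.hub.y < 3 * m * k
  z_nonneg : 0 ≤ u.hub.z
  z_lt : u.hub.z < 6 * m * k ^ 2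

/-- The three kinds of edges: a biclique between the ports of the two sides of a junction, the edges
along an arm, and an edge between the tips of the two arms that form one outer edge. So the ports at
the two ends of an outer edge have distance `8 m - 1`. -/
inductive Link (m k : ℤ) : Site → Site → Prop
  | port (v : Junction) {s s' : Bool} (d d' : ℤ) (h : s ≠ s') : Link m k ⟨v, s, d, 0⟩ ⟨v, s', d', 0⟩
  | up (v : Junction) (s : Bool) (d h : ℤ) : Link m k ⟨v, s, d, h⟩ ⟨v, s, d, h + 1⟩
  | down (v : Junction) (s : Bool) (d h : ℤ) : Link m k ⟨v, s, d, h + 1⟩ ⟨v, s, d, h⟩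
  | cross (v : Junction) (s : Bool) (d : ℤ) :
    Link m k ⟨v, s, d, 4 * m - 1⟩ ⟨across k v s d, s, d, 4 * m - 1⟩

theorem Link.symm {u v : Site} (h : Link m k u v) : Link m k v u := by
  cases h with
  | port v d d' h => exact .port v d' d h.symm
  | up v s d h => exact .down v s d h
  | down v s d h => exact .up v s d h
  | cross v s d =>
    have := Link.cross (m := m) (k := k) (across k v s d) s d
    rwa [across_across] at this

theorem Link.ne {u v : Site} (h : Link m k u v) : u ≠ v := by
  cases h with
  | port v d d' h => simp [h]
  | up v s d h => simp
  | down v s d h => simp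
  | cross v s d => simp [(across_ne v s d).symm]

/-- The graph on the valid sites; all other sites are isolated. -/
def siteGraph (m k : ℤ) : SimpleGraph Site where
  Adj u v := u.Valid m k ∧ v.Valid m k ∧ Link m k u v
  symm := ⟨fun _ _ h => ⟨h.2.1, h.1, h.2.2.symm⟩⟩
  loopless := ⟨fun _ h => h.2.2.ne rfl⟩

/-! ### Local lower bounds for distances -/

/-- An integer potential that increases by at most `1` along edges bounds distances from below. -/
theorem le_add_length {V : Type*} {G : SimpleGraph V} {f : V → ℤ}
    (hf : ∀ u v, G.Adj u v → f v ≤ f u + 1) {u v : V} (p : G.Walk u v) :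
    f v ≤ f u + p.length := by
  induction p with
  | nil => simp
  | cons h p ih =>
    have := hf _ _ h
    simp only [SimpleGraph.Walk.length_cons]; push_cast; linarith

open Classical in
/-- Lower bounds for the distance of two sites of one junction. They come from a potential that
descends along the outer edge of `u` and is almost constant elsewhere, so that detours through other
junctions are covered. -/
theorem same_hub_le {u w : Site} (hu : u.Valid m k) (hw : w.Valid m k) (huw : u.hub = w.hub)
    (p : (siteGraph m k).Walk u w) :
    (u.s = w.s → u.d = w.d → u.h - w.h ≤ p.length) ∧
    (u.s = w.s → u.d ≠ w.d → u.h + 2 ≤ p.length) ∧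
    (u.s ≠ w.s → u.h + 1 ≤ p.length) := by
  obtain ⟨v, s, d, h₀⟩ := u
  let f : Site → ℤ := fun z =>
    if (z.hub = v ∨ z.hub = across k v s d) ∧ z.s = s ∧ z.d = d then -z.h
    else if z.hub = v ∧ z.s = s then 2 else 1
  have hd := hu.d_nonneg
  have hdk := hu.d_lt
  simp only at hd hdk huw
  have hf : ∀ a b, (siteGraph m k).Adj a b → f b ≤ f a + 1 := by
    rintro a b ⟨ha, hb, hab⟩
    have hne := across_ne (k := k) v s d
    have hinj : ∀ s' d', 0 ≤ d' → d' < k → across k v s d = across k v s' d' → s = s' ∧ d = d' :=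
      fun s' d' h1 h2 => across_injective hd hdk h1 h2
    cases hab with
    | port y d₁ d₂ hs => simp only [f]; grind
    | up y s₁ d₁ h => simp only [f]; grind
    | down y s₁ d₁ h => simp only [f]; grind
    | cross y s₁ d₁ =>
      have h1 := ha.d_nonneg
      have h2 := ha.d_lt
      have hm := ha.h_nonneg
      simp only at h1 h2 hm
      have e1 := across_across (k := k) y s₁ d₁
      have e2 := across_across (k := k) v s d
      simp only [f]
      by_cases c1 : y = v
      · subst c1; grind
      · grind
  have := le_add_length hf p
  obtain ⟨v', s', d', h'⟩ := w
  simp only at huw ⊢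
  subst huw
  have e1 : f ⟨v, s, d, h₀⟩ = -h₀ := by simp [f]
  rw [e1] at this
  have hne := across_ne (k := k) v s d
  refine ⟨?_, ?_, ?_⟩
  · rintro rfl rfl
    simp [f] at this; linarith
  · rintro rfl hdd
    simp [f, Ne.symm hdd] at this; linarith
  · intro hss
    simp [f, Ne.symm hss] at this; linarith

open Classical in
/-- The position of `u` relative to the port where the route with labels `lab` enters its hub: the
signed distance in the hub without the biclique edge of the route, where the exit port is at
distance `3`. The arms that the route does not use have the constant value of their ports. -/
noncomputable def offset (lab : Bool → ℤ) (u : Site) : ℤ :=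
  if u.s = u.hub.c then if u.d = lab u.s then 3 + u.h else 1
  else if u.d = lab u.s then -u.h else 2

open Classical in
/-- Within a junction, only a pair from the incoming to the outgoing arm of the route can be closer
than the difference of the offsets. -/
theorem offset_sub_le_same {u w : Site} (hu : u.Valid m k) (hw : w.Valid m k)
    (huw : u.hub = w.hub)
    (hch : ¬ (u.s ≠ u.hub.c ∧ u.d = lab u.s ∧ w.s = u.hub.c ∧ w.d = lab w.s))
    (p : (siteGraph m k).Walk u w) : offset lab w - offset lab u ≤ p.length := by
  obtain ⟨a1, a2, a3⟩ := same_hub_le hu hw huw p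
  obtain ⟨b1, b2, b3⟩ := same_hub_le hw hu huw.symm p.reverse
  rw [SimpleGraph.Walk.length_reverse] at b1 b2 b3
  have h1 := hu.h_nonneg
  have h2 := hw.h_nonneg
  have hp : (0 : ℤ) ≤ p.length := by positivity
  unfold offset
  have : u.s ≠ u.hub.c → w.s ≠ u.hub.c → u.s = w.s := by
    cases u.s <;> cases w.s <;> cases u.hub.c <;> decide
  grind

open Classical in
/-- For sites at consecutive junctions of the route, the difference of the offsets, plus the cost
`8 m + 2` of one step without biclique edges of the route, bounds the distance from below, unless
the first site is on the incoming or the second on the outgoing arm of the route. Sites on other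
arms have to be low: from the tip of such an arm there may be a shortcut. -/
theorem offset_sub_le_next (hm : 2 ≤ m) (hlab : ∀ b, 0 ≤ lab b ∧ lab b < k) {u w : Site}
    (hu : u.Valid m k) (hw : w.Valid m k) (huw : w.hub = adv k lab u.hub)
    (hul : u.h < 2 * m ∨ u.d = lab u.s) (hwl : w.h < 2 * m ∨ w.d = lab w.s)
    (hu' : ¬ (u.s ≠ u.hub.c ∧ u.d = lab u.s)) (hw' : ¬ (w.s = w.hub.c ∧ w.d = lab w.s))
    (p : (siteGraph m k).Walk u w) : 8 * m + 2 + offset lab w - offset lab u ≤ p.length := by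
  obtain ⟨v, s₀, d₀, h₀⟩ := u
  obtain ⟨v', s₁, d₁, h₁⟩ := w
  simp only at huw hul hwl hu' hw'
  have hv'c : v'.c = !v.c := by rw [huw, adv, across_c]
  -- The potential `f` runs from `0` to `8 * m - 1` along the outer edge of the route. It goes from
  -- the values `b`, `b'` at the other ports of `v` and `v'` to the value `4 * m`, which it has
  -- everywhere else, along the edges of these ports, starting at height `2 * m`.
  let e := lab v.c
  let b : Bool → ℤ := fun s => if s = v.c then -2 else -1
  let b' : Bool → ℤ := fun s => if s = v.c then 8 * m + 1 else 8 * m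
  let f : Site → ℤ := fun z =>
    if z.hub = v then
      if z.s = v.c ∧ z.d = e then z.h else b z.s + max 0 (z.h - 2 * m)
    else if z.hub = v' then
      if z.s = v.c ∧ z.d = e then 8 * m - 1 - z.h else b' z.s - max 0 (z.h - 2 * m)
    else if across k z.hub z.s z.d = v then min (4 * m) (b z.s + (6 * m - 1 - z.h))
    else if across k z.hub z.s z.d = v' then max (4 * m) (b' z.s - (6 * m - 1 - z.h))
    else 4 * m
  have he := hlab v.c
  have hve : v' = across k v v.c e := huw
  have hev : across k v' v.c e = v := by rw [hve, across_across]
  have hne : v' ≠ v := by rw [hve]; exact across_ne _ _ _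
  have hinj : ∀ s' d', 0 ≤ d' → d' < k → across k v s' d' = v' → s' = v.c ∧ d' = e :=
    fun s' d' h1 h2 h3 => across_injective h1 h2 he.1 he.2 (h3.trans hve)
  have hinj' : ∀ s' d', 0 ≤ d' → d' < k → across k v' s' d' = v → s' = v.c ∧ d' = e :=
    fun s' d' h1 h2 h3 => across_injective h1 h2 he.1 he.2 (h3.trans hev.symm)
  have hb : ∀ s, b s = -2 ∨ b s = -1 := by intro s; simp only [b]; split <;> simp
  have hb' : ∀ s, b' s = 8 * m + 1 ∨ b' s = 8 * m := by intro s; simp only [b']; split <;> simp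
  have hf : ∀ a b, (siteGraph m k).Adj a b → f b ≤ f a + 1 := by
    rintro a b ⟨ha, hb, hab⟩
    cases hab with
    | port y d₁ d₂ hs => simp only [f]; grind
    | up y s₁ d₁ h =>
      have := hb.h_lt
      have := ha.h_nonneg
      simp only [f]; grind
    | down y s₁ d₁ h =>
      have := hb.h_nonneg
      have := ha.h_lt
      simp only [f]; grind
    | cross y s₁ d₁ =>
      have h1 := ha.d_nonneg
      have h2 := ha.d_lt
      simp only at h1 h2
      have e1 := across_across (k := k) y s₁ d₁
      have e2 := across_ne (k := k) y s₁ d₁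
      have e3 := hinj s₁ d₁ h1 h2
      have e4 := hinj' s₁ d₁ h1 h2
      simp only [f]
      by_cases c1 : y = v
      · subst c1; grind
      · by_cases c2 : y = v'
        · grind
        · grind
  have := le_add_length hf p
  have h1 := hu.h_nonneg
  have h2 := hw.h_nonneg
  simp only at h1 h2
  have : f ⟨v, s₀, d₀, h₀⟩ = offset lab ⟨v, s₀, d₀, h₀⟩ - 3 := by
    simp only [f, offset]; grind
  have : f ⟨v', s₁, d₁, h₁⟩ = offset lab ⟨v', s₁, d₁, h₁⟩ + (8 * m - 1) := by
    simp only [f, offset]; grind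
  linarith

/-! ### Sites near a route -/

/-- The number `n` is at least the distance from a port of `v₀` to `u` when biclique edges are free;
the two alternatives are the two ends of the outer edge of `u` through which `u` may be entered. -/
def DistBound (m k : ℤ) (v₀ : Junction) (n : ℕ) (u : Site) : Prop :=
  ∃ a : ℕ, (Steps k a v₀ u.hub ∧ (8 * m - 1) * a + u.h ≤ n) ∨
    (Steps k a v₀ (across k u.hub u.s u.d) ∧ (8 * m - 1) * a + (8 * m - 1 - u.h) ≤ n)

theorem DistBound.adj {v₀ : Junction} {n : ℕ} {u w : Site} (h : DistBound m k v₀ n u)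
    (huw : (siteGraph m k).Adj u w) : DistBound m k v₀ (n + 1) w := by
  obtain ⟨hu, hw, huw⟩ := huw
  obtain ⟨a, h⟩ := h
  cases huw with
  | @port v s s' d d' hs =>
    rcases h with ⟨h1, h2⟩ | ⟨h1, h2⟩
    · exact ⟨a, .inl ⟨h1, by push_cast; simp only at h2 ⊢; linarith⟩⟩
    · refine ⟨a + 1, .inl ⟨?_, by push_cast; simp only at h2 ⊢; linarith⟩⟩
      have := h1.step s hu.d_nonneg hu.d_lt
      rwa [across_across] at this
  | up v s d h' =>
    rcases h with ⟨h1, h2⟩ | ⟨h1, h2⟩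
    · exact ⟨a, .inl ⟨h1, by push_cast; simp only at h2 ⊢; linarith⟩⟩
    · exact ⟨a, .inr ⟨h1, by push_cast; simp only at h2 ⊢; linarith⟩⟩
  | down v s d h' =>
    rcases h with ⟨h1, h2⟩ | ⟨h1, h2⟩
    · exact ⟨a, .inl ⟨h1, by push_cast; simp only at h2 ⊢; linarith⟩⟩
    · exact ⟨a, .inr ⟨h1, by push_cast; simp only at h2 ⊢; linarith⟩⟩
  | cross v s d =>
    rcases h with ⟨h1, h2⟩ | ⟨h1, h2⟩
    · refine ⟨a, .inr ⟨by rwa [across_across], by push_cast; simp only at h2 ⊢; linarith⟩⟩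
    · refine ⟨a, .inl ⟨h1, by push_cast; simp only at h2 ⊢; linarith⟩⟩

theorem DistBound.walk {v₀ : Junction} {n : ℕ} {u w : Site} (h : DistBound m k v₀ n u)
    (p : (siteGraph m k).Walk u w) : DistBound m k v₀ (n + p.length) w := by
  induction p generalizing n with
  | nil => exact h
  | cons huv p ih =>
    have := ih (h.adj huv)
    rwa [SimpleGraph.Walk.length_cons, Nat.add_comm p.length, ← Nat.add_assoc]

theorem distBound_of_walk {u w : Site} (hu : u.h = 0) (p : (siteGraph m k).Walk u w) :
    DistBound m k u.hub p.length w := by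
  have h : DistBound m k u.hub 0 u := ⟨0, .inl ⟨.refl _, by simp [hu]⟩⟩
  simpa using h.walk p

/-- The site `u` belongs to the `j`-th junction of the route with start `v₀` and labels `lab`, and it
is low or on an arm of the route. -/
def Near (m k : ℤ) (lab : Bool → ℤ) (v₀ : Junction) (j : ℕ) (u : Site) : Prop :=
  u.hub = (adv k lab)^[j] v₀ ∧ (u.h < 2 * m ∨ u.d = lab u.s)

/-- A site on a short walk between the ends of a route is near the route. -/
theorem exists_near (hm : 1 ≤ m) (hlab : ∀ b, 0 ≤ lab b ∧ lab b < k) {l : ℕ} {v₀ : Junction}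
    {s u t : Site} (hs : s.h = 0) (ht : t.h = 0) (hu : u.Valid m k) (hsv : s.hub = v₀)
    (htv : t.hub = (adv k lab)^[l] v₀) (p : (siteGraph m k).Walk s u)
    (q : (siteGraph m k).Walk u t) (hpq : (p.length : ℤ) + q.length < (8 * m - 1) * l + 4 * m) :
    ∃ j, Near m k lab v₀ j u := by
  obtain ⟨a, ha⟩ := distBound_of_walk hs p
  obtain ⟨b, hb⟩ := distBound_of_walk ht q.reverse
  rw [SimpleGraph.Walk.length_reverse] at hb
  rw [hsv] at ha
  rw [htv] at hb
  have h0 := hu.h_nonneg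
  have h1 := hu.h_lt
  have key : ∀ c : ℕ, (8 * m - 1) * (c : ℤ) < (8 * m - 1) * (l + 1) → c ≤ l := by
    intro c hc
    have := lt_of_mul_lt_mul_left hc (by linarith)
    omega
  rcases ha with ⟨ha, ha'⟩ | ⟨ha, ha'⟩ <;> rcases hb with ⟨hb, hb'⟩ | ⟨hb, hb'⟩
  · obtain ⟨e, hx⟩ := ha.eq_iterate_of_add_le hlab hb (key _ (by push_cast; linarith))
    refine ⟨a, hx, .inl ?_⟩
    rw [← e] at hpq; push_cast at hpq
    linarith
  · have hle : a + 1 + b ≤ l := key _ (by push_cast; linarith)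
    obtain ⟨-, hy⟩ := (ha.step u.s hu.d_nonneg hu.d_lt).eq_iterate_of_add_le hlab hb hle
    obtain ⟨-, hx⟩ := ha.eq_iterate_of_add_le hlab (w := u.hub) (b := b + 1) (n := l) (by
      have := hb.step u.s hu.d_nonneg hu.d_lt
      rwa [across_across] at this) (by omega)
    refine ⟨a, hx, .inr ?_⟩
    rw [Function.iterate_succ_apply', ← hx] at hy
    obtain ⟨e1, e2⟩ := across_injective hu.d_nonneg hu.d_lt (hlab _).1 (hlab _).2 hy
    rw [e2, e1]
  · have hle : a + (b + 1) ≤ l := key _ (by push_cast; linarith)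
    obtain ⟨-, hy⟩ := ha.eq_iterate_of_add_le hlab (hb.step u.s hu.d_nonneg hu.d_lt) hle
    have ha2 := ha.step u.s hu.d_nonneg hu.d_lt
    rw [across_across] at ha2
    obtain ⟨-, hx⟩ := ha2.eq_iterate_of_add_le hlab hb (by omega)
    refine ⟨a + 1, hx, .inr ?_⟩
    rw [Function.iterate_succ_apply', ← hy] at hx
    -- the route enters `u.hub` by the arm that leads back to the previous junction
    have back : ∀ {x y : Junction}, x = adv k lab y → across k x y.c (lab y.c) = y := by
      rintro _ y rfl
      exact across_across ..
    have hx' : across k u.hub (across k u.hub u.s u.d).c (lab (across k u.hub u.s u.d).c) =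
        across k u.hub u.s u.d := back hx
    obtain ⟨e1, e2⟩ := across_injective (hlab _).1 (hlab _).2 hu.d_nonneg hu.d_lt hx'
    rw [← e2, e1]
  · exfalso
    have hle : a + b + 1 ≤ l := key _ (by push_cast; linarith)
    have := (ha.eq_iterate_of_add_le hlab hb (by omega)).1
    omega

/-! ### Pairs that can use biclique edges of a route -/

/-- The pair `(u, w)` is charged to a route: it is one of those whose distance may profit from the
biclique edges of the route. The four kinds `t` are: it passes the biclique of one junction from the
incoming to the outgoing arm; it goes to the next junction, starting on the incoming arm; it goes to
the next junction, ending on the outgoing arm; it goes at least two junctions ahead. -/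
def Charged (k : ℤ) (lab : Bool → ℤ) (v₀ : Junction) (u w : Site) (t : Fin 4) : Prop :=
  ∃ i j : ℕ, u.hub = (adv k lab)^[i] v₀ ∧ w.hub = (adv k lab)^[j] v₀ ∧
    match t with
    | 0 => i = j ∧ (u.s ≠ u.hub.c ∧ u.d = lab u.s ∧ w.s = u.hub.c ∧ w.d = lab w.s)
    | 1 => j = i + 1 ∧ (u.s ≠ u.hub.c ∧ u.d = lab u.s)
    | 2 => j = i + 1 ∧ (w.s = w.hub.c ∧ w.d = lab w.s)
    | 3 => i + 2 ≤ j

/-- In each of the four kinds a pair shows both labels of the route, either as the label of an arm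
or through the displacement of its hubs. -/
theorem Charged.labels_eq (hlab : ∀ b, 0 ≤ lab b ∧ lab b < k)
    (hlab' : ∀ b, 0 ≤ lab' b ∧ lab' b < k) {v v' : Junction} {u w : Site} {t : Fin 4}
    (h : Charged k lab v u w t) (h' : Charged k lab' v' u w t) : lab = lab' := by
  obtain ⟨i, j, hu, hw, h⟩ := h
  obtain ⟨i', j', hu', hw', h'⟩ := h'
  have next : j = i + 1 → j' = i' + 1 → w.hub.c = (!u.hub.c) ∧ lab u.hub.c = lab' u.hub.c := by
    rintro rfl rfl
    rw [Function.iterate_succ_apply', ← hu] at hw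
    rw [Function.iterate_succ_apply', ← hu'] at hw'
    refine ⟨by rw [hw, adv, across_c], ?_⟩
    exact (across_injective (hlab _).1 (hlab _).2 (hlab' _).1 (hlab' _).2 (hw.symm.trans hw')).2
  have ext : lab u.hub.c = lab' u.hub.c → lab (!u.hub.c) = lab' (!u.hub.c) → lab = lab' := by
    intro h1 h2
    funext b
    rcases Bool.eq_or_eq_not b u.hub.c with rfl | rfl
    · exact h1
    · exact h2
  match t with
  | 0 =>
    obtain ⟨-, h1, h2, h3, h4⟩ := h
    obtain ⟨-, -, h2', -, h4'⟩ := h'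
    rw [Bool.eq_not_of_ne h1] at h2 h2'
    rw [h3] at h4 h4'
    exact ext (h4.symm.trans h4') (h2.symm.trans h2')
  | 1 =>
    obtain ⟨hj, h1, h2⟩ := h
    obtain ⟨hj', -, h2'⟩ := h'
    rw [Bool.eq_not_of_ne h1] at h2 h2'
    exact ext (next hj hj').2 (h2.symm.trans h2')
  | 2 =>
    obtain ⟨hj, h1, h2⟩ := h
    obtain ⟨hj', -, h2'⟩ := h'
    rw [h1, (next hj hj').1] at h2 h2'
    exact ext (next hj hj').2 (h2.symm.trans h2')
  | 3 =>
    obtain ⟨r, rfl⟩ := Nat.exists_eq_add_of_le h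
    obtain ⟨r', rfl⟩ := Nat.exists_eq_add_of_le h'
    rw [show i + 2 + r = (r + 2) + i by ring, Function.iterate_add_apply, ← hu] at hw
    rw [show i' + 2 + r' = (r' + 2) + i' by ring, Function.iterate_add_apply, ← hu'] at hw'
    exact labels_unique hlab hlab' (by omega) (by omega) (hw.symm.trans hw')

/-- The progress along the route of a site at its `j`-th junction: a potential for the graph without
the biclique edges of the route, where one step costs `8 m + 2` instead of `8 m`. -/
noncomputable def progress (m : ℤ) (lab : Bool → ℤ) (j : ℕ) (u : Site) : ℤ :=
  j * (8 * m + 2) + offset lab u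

/-- For sites near a route, the progress grows by at most the distance, unless the pair is charged
to the route. -/
theorem progress_sub_le (hm : 2 ≤ m) (hlab : ∀ b, 0 ≤ lab b ∧ lab b < k) {v₀ : Junction}
    {u w : Site} (hu : u.Valid m k) (hw : w.Valid m k) {i j : ℕ} (hui : Near m k lab v₀ i u)
    (hwj : Near m k lab v₀ j w) (hch : ∀ t, ¬ Charged k lab v₀ u w t)
    (p : (siteGraph m k).Walk u w) : progress m lab j w - progress m lab i u ≤ p.length := by
  obtain ⟨hui, hui'⟩ := hui
  obtain ⟨hwj, hwj'⟩ := hwj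
  unfold progress
  have hlt : i < j ∨ i = j ∨ j < i := lt_trichotomy i j
  rcases hlt with hij | rfl | hij
  · have : j = i + 1 := by
      by_contra hne
      exact hch 3 ⟨i, j, hui, hwj, by change i + 2 ≤ j; omega⟩
    subst this
    have h1 := offset_sub_le_next hm hlab hu hw
      (by rw [hwj, hui, Function.iterate_succ_apply']) hui' hwj'
      (fun h => hch 1 ⟨i, _, hui, hwj, rfl, h⟩) (fun h => hch 2 ⟨i, _, hui, hwj, rfl, h⟩) p
    push_cast; linarith
  · have := offset_sub_le_same (lab := lab) hu hw (hui.trans hwj.symm)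
      (fun h => hch 0 ⟨i, i, hui, hwj, rfl, h⟩) p
    linarith
  · have h1 := hu.h_nonneg
    have h2 := hw.h_nonneg
    have h3 := hu.h_lt
    have h4 := hw.h_lt
    have h5 : (j : ℤ) + 1 ≤ i := by exact_mod_cast hij
    -- the offsets at one junction vary by less than the cost of a step
    have h6 : ((j : ℤ) + 1) * (8 * m + 2) ≤ i * (8 * m + 2) :=
      mul_le_mul_of_nonneg_right h5 (by linarith)
    have h7 : offset lab w ≤ 3 + w.h ∧ -u.h ≤ offset lab u := by
      unfold offset; grind
    have : (0 : ℤ) ≤ p.length := by positivity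
    linarith [h7.1, h7.2]

/-! ### Routes -/

/-- The start `v₀` and the labels of a route, which makes `2 m` steps; the start is in a part of the
box such that the route stays in the box. -/
structure IsRoute (m k : ℤ) (lab : Bool → ℤ) (v₀ : Junction) : Prop where
  lab_mem : ∀ b, 0 ≤ lab b ∧ lab b < k
  c_eq : v₀.c = false
  x_nonneg : 0 ≤ v₀.x
  x_lt : v₀.x < m * k
  y_nonneg : 0 ≤ v₀.y
  y_lt : v₀.y < m * k
  z_nonneg : 0 ≤ v₀.z
  z_lt : v₀.z < 2 * k ^ 2

/-- For each kind, a pair of sites is charged to at most one route. -/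
theorem Charged.eq {v v' : Junction} {u w : Site} {t : Fin 4} (hv : IsRoute m k lab v)
    (hv' : IsRoute m k lab' v') (h : Charged k lab v u w t) (h' : Charged k lab' v' u w t) :
    lab = lab' ∧ v = v' := by
  obtain rfl := h.labels_eq hv.lab_mem hv'.lab_mem h'
  obtain ⟨i, -, hu, -⟩ := h
  obtain ⟨i', -, hu', -⟩ := h'
  exact ⟨rfl, start_unique hv.lab_mem ⟨hv.z_nonneg, hv.z_lt⟩ ⟨hv'.z_nonneg, hv'.z_lt⟩
    (hv.c_eq.trans hv'.c_eq.symm) (hu.symm.trans hu')⟩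

theorem IsRoute.valid {v₀ : Junction} (hv : IsRoute m k lab v₀) (hm : 1 ≤ m) {j : ℕ}
    (hj : (j : ℤ) ≤ 2 * m) (s : Bool) {h : ℤ} (h0 : 0 ≤ h) (hlt : h < 4 * m) :
    Site.Valid m k ⟨(adv k lab)^[j] v₀, s, lab s, h⟩ := by
  obtain ⟨⟨hx, hx'⟩, ⟨hy, hy'⟩, hz, hz'⟩ := iterate_adv_bounds hv.lab_mem j v₀
  have hl := hv.lab_mem s
  have h1 : (j : ℤ) * k ≤ 2 * m * k := mul_le_mul_of_nonneg_right hj (by linarith)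
  have h2 : (j : ℤ) * (2 * k ^ 2) ≤ 2 * m * (2 * k ^ 2) :=
    mul_le_mul_of_nonneg_right hj (by positivity)
  have h3 : (0 : ℤ) ≤ j * k ^ 2 := by positivity
  have h4 : k ^ 2 * 1 ≤ k ^ 2 * m := mul_le_mul_of_nonneg_left hm (sq_nonneg k)
  exact ⟨hl.1, hl.2, h0, hlt, hv.x_nonneg.trans hx, by linarith [hv.x_lt],
    hv.y_nonneg.trans hy, by linarith [hv.y_lt], by linarith [hv.z_nonneg],
    by linarith [hv.z_lt]⟩

theorem exists_arm_walk {v : Junction} {s : Bool} {d : ℤ} (n : ℕ)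
    (hv : ∀ h : ℤ, 0 ≤ h → h ≤ n → Site.Valid m k ⟨v, s, d, h⟩) :
    ∃ p : (siteGraph m k).Walk ⟨v, s, d, 0⟩ ⟨v, s, d, n⟩, p.length = n := by
  induction n with
  | zero => exact ⟨SimpleGraph.Walk.nil, rfl⟩
  | succ n ih =>
    obtain ⟨p, hp⟩ := ih fun h h0 hn => hv h h0 (by push_cast; linarith)
    have hadj : (siteGraph m k).Adj ⟨v, s, d, n⟩ ⟨v, s, d, (n + 1 : ℕ)⟩ := by
      refine ⟨hv n (by positivity) (by simp), hv _ (by positivity) le_rfl, ?_⟩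
      push_cast
      exact .up v s d n
    exact ⟨p.concat hadj, by rw [SimpleGraph.Walk.length_concat, hp]⟩

/-- The port through which the route with labels `lab` enters the junction `v`. -/
def entry (lab : Bool → ℤ) (v : Junction) : Site := ⟨v, !v.c, lab (!v.c), 0⟩

theorem IsRoute.exists_walk_entry {M : ℕ} {v₀ : Junction} (hv : IsRoute M k lab v₀) (hm : 1 ≤ M)
    {j : ℕ} (hj : j < 2 * M) :
    ∃ p : (siteGraph M k).Walk (entry lab ((adv k lab)^[j] v₀))
      (entry lab ((adv k lab)^[j + 1] v₀)), p.length = 8 * M := by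
  have hm' : (1 : ℤ) ≤ M := by exact_mod_cast hm
  have val := fun (i : ℕ) (hi : i ≤ 2 * M) (s : Bool) (h : ℤ) (h0 : 0 ≤ h)
    (hlt : h < 4 * (M : ℤ)) => hv.valid hm' (j := i) (by exact_mod_cast hi) s h0 hlt
  have hj1 := val j (by omega)
  have hj2 := val (j + 1) (by omega)
  have hadv : (adv k lab)^[j + 1] v₀ = adv k lab ((adv k lab)^[j] v₀) :=
    Function.iterate_succ_apply' ..
  generalize (adv k lab)^[j] v₀ = v at *
  generalize (adv k lab)^[j + 1] v₀ = w at *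
  have hwc : (!w.c) = v.c := by rw [hadv, adv, across_c, Bool.not_not]
  obtain ⟨n, hn⟩ : ∃ n : ℕ, 4 * M = n + 1 := ⟨4 * M - 1, by omega⟩
  have hn' : 4 * (M : ℤ) - 1 = n := by have : (4 * M : ℤ) = n + 1 := by exact_mod_cast hn
                                       linarith
  obtain ⟨p, hp⟩ := exists_arm_walk (m := M) (k := k) (v := v) (s := v.c) (d := lab v.c) n
    fun h h0 hh => hj1 _ h h0 (by linarith)
  obtain ⟨q, hq⟩ := exists_arm_walk (m := M) (k := k) (v := w) (s := v.c) (d := lab v.c) n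
    fun h h0 hh => hj2 _ h h0 (by linarith)
  have h1 : (siteGraph M k).Adj (entry lab v) ⟨v, v.c, lab v.c, 0⟩ :=
    ⟨hj1 _ 0 le_rfl (by linarith), hj1 _ 0 le_rfl (by linarith), .port _ _ _ (by simp)⟩
  have h2 : (siteGraph M k).Adj ⟨v, v.c, lab v.c, n⟩ ⟨w, v.c, lab v.c, n⟩ := by
    refine ⟨hj1 _ _ (by positivity) (by linarith), hj2 _ _ (by positivity) (by linarith), ?_⟩
    rw [← hn', hadv]
    exact .cross _ _ _
  have he : entry lab w = ⟨w, v.c, lab v.c, 0⟩ := by rw [entry, hwc]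
  rw [he]
  refine ⟨.cons h1 (p.append (.cons h2 q.reverse)), ?_⟩
  simp only [SimpleGraph.Walk.length_cons, SimpleGraph.Walk.length_append,
    SimpleGraph.Walk.length_reverse, hp, hq]
  omega

theorem IsRoute.exists_walk {M : ℕ} {v₀ : Junction} (hv : IsRoute M k lab v₀) (hm : 1 ≤ M)
    (j : ℕ) (hj : j ≤ 2 * M) :
    ∃ p : (siteGraph M k).Walk (entry lab v₀) (entry lab ((adv k lab)^[j] v₀)),
      p.length = j * (8 * M) := by
  induction j with
  | zero => exact ⟨SimpleGraph.Walk.nil, by simp⟩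
  | succ j ih =>
    obtain ⟨p, hp⟩ := ih (by omega)
    obtain ⟨q, hq⟩ := hv.exists_walk_entry hm (j := j) (by omega)
    exact ⟨p.append q, by rw [SimpleGraph.Walk.length_append, hp, hq]; ring⟩

/-! ### Emulators and charging -/

section Emulator

variable {V : Type*}

theorem exists_walk_of_edist_le {G : SimpleGraph V} {a b : V} {r : ℝ≥0}
    (h : (G.edist a b : ℝ≥0∞) ≤ r) : ∃ p : G.Walk a b, (p.length : ℝ) ≤ r := by
  have hne : G.edist a b ≠ ⊤ := by
    intro he
    rw [he] at h
    simp at h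
  obtain ⟨p, hp⟩ := SimpleGraph.exists_walk_of_edist_ne_top hne
  refine ⟨p, ?_⟩
  rw [← hp] at h
  have : ((p.length : ℝ≥0) : ℝ≥0∞) ≤ r := by simpa using h
  exact_mod_cast ENNReal.coe_le_coe.1 this

theorem exists_walk_of_walk {H : WeightedGraph V} {f : V → Site} {β : ℝ≥0}
    (hH : H.IsEmulator ((siteGraph m k).comap f) β) {a b : V} (Q : H.graph.Walk a b) :
    ∃ p : (siteGraph m k).Walk (f a) (f b), (p.length : ℝ) ≤ H.walkWeight Q := by
  obtain ⟨p, hp⟩ := exists_walk_of_edist_le ((hH a b).1.trans (iInf_le _ Q))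
  exact ⟨p.map (SimpleGraph.Hom.comap f _), 
    (Nat.cast_le.2 (SimpleGraph.Walk.length_map (SimpleGraph.Hom.comap f _) p).le).trans hp⟩

theorem walkWeight_cons (H : WeightedGraph V) {a b c : V} (h : H.graph.Adj a b)
    (Q : H.graph.Walk b c) :
    H.walkWeight (.cons h Q) = H.walkWeight (.cons h .nil) + H.walkWeight Q := by
  simp [WeightedGraph.walkWeight]

/-- A walk of the emulator that is light enough stays near the route; if no edge of the emulator is
charged to the route, the progress of its end is paid for by the weight. The walk `p` of the graph
replaces the part of the emulator walk before `a`. -/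
theorem progress_sub_le_walkWeight (hm : 2 ≤ m) (hlab : ∀ b, 0 ≤ lab b ∧ lab b < k)
    {v₀ : Junction} {H : WeightedGraph V} {f : V → Site} {β : ℝ≥0}
    (hH : H.IsEmulator ((siteGraph m k).comap f) β) (hf : ∀ a, (f a).Valid m k)
    (hch : ∀ a b, H.graph.Adj a b → ∀ t, ¬ Charged k lab v₀ (f a) (f b) t)
    {l : ℕ} {s : Site} (hs : s.h = 0) (hsv : s.hub = v₀) {a b : V} (Q : H.graph.Walk a b)
    (hb : (f b).h = 0) (hbv : (f b).hub = (adv k lab)^[l] v₀) (p : (siteGraph m k).Walk s (f a))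
    (hp : (p.length : ℝ) + H.walkWeight Q < (8 * m - 1) * l + 4 * m) {i : ℕ}
    (hi : Near m k lab v₀ i (f a)) :
    (progress m lab l (f b) - progress m lab i (f a) : ℝ) ≤ H.walkWeight Q := by
  induction Q generalizing i with
  | @nil a =>
    have hil : i = l := by
      have h := hi.1.symm.trans hbv
      have h' := congrArg (energy lab) h
      rw [energy_iterate_adv, energy_iterate_adv, add_right_inj] at h'
      exact_mod_cast mul_right_cancel₀ (gain_pos hlab).ne' h'
    simp [hil]
  | @cons a a' b h Q ih =>
    rw [walkWeight_cons] at hp ⊢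
    push_cast at hp ⊢
    obtain ⟨q, hq⟩ := exists_walk_of_walk hH (.cons h .nil)
    obtain ⟨q', hq'⟩ := exists_walk_of_walk hH Q
    have hpq : ((p.append q).length : ℝ) + H.walkWeight Q < (8 * m - 1) * l + 4 * m := by
      rw [SimpleGraph.Walk.length_append]
      push_cast; linarith
    obtain ⟨j, hj⟩ := exists_near (by linarith) hlab hs hb (hf a') hsv hbv (p.append q) q' (by
      have : ((p.append q).length : ℝ) + q'.length < (8 * m - 1) * l + 4 * m := by linarith
      exact_mod_cast this)
    have h1 := ih hb hbv (p.append q) hpq hj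
    have h2 := progress_sub_le hm hlab (hf a) (hf a') hi hj (hch _ _ h) q
    have h3 : (progress m lab j (f a') - progress m lab i (f a) : ℝ) ≤ q.length := by
      exact_mod_cast h2
    linarith

/-- If the stretch is below `2 M`, some edge of the emulator is charged to the route: the ends of the
route have distance at most `16 M²`, but without charged edges `2 M` bicliques cost `2` more each.
The finite graph is `siteGraph`, transported along `f` with right inverse `g` on the valid sites. -/
theorem exists_charged {M : ℕ} (hM : 2 ≤ M) {v₀ : Junction} (hv : IsRoute M k lab v₀)
    {H : WeightedGraph V} {f : V → Site} {g : Site → V} {β : ℝ≥0}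
    (hH : H.IsEmulator ((siteGraph M k).comap f) β) (hf : ∀ a, (f a).Valid M k)
    (hg : ∀ u : Site, u.Valid M k → f (g u) = u) (hβ : (β : ℝ) < 2 * M) :
    ∃ a b, H.graph.Adj a b ∧ ∃ t, Charged k lab v₀ (f a) (f b) t := by
  by_contra! hch
  have hM' : (2 : ℤ) ≤ M := by exact_mod_cast hM
  let t := entry lab ((adv k lab)^[2 * M] v₀)
  have valid : ∀ j ≤ 2 * M, (entry lab ((adv k lab)^[j] v₀)).Valid M k := fun j hj =>
    hv.valid (by linarith) (by exact_mod_cast hj) _ le_rfl (by linarith)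
  have hfs : f (g (entry lab v₀)) = entry lab v₀ := hg _ (valid 0 (by omega))
  have hft : f (g t) = t := hg _ (valid _ le_rfl)
  let φ : siteGraph M k →g (siteGraph M k).comap f :=
    ⟨g, fun {u w} h => by
      change (siteGraph M k).Adj (f (g u)) (f (g w))
      rwa [hg u h.1, hg w h.2.1]⟩
  obtain ⟨P, hP⟩ := hv.exists_walk (by omega) (2 * M) le_rfl
  have hup : H.edist (g (entry lab v₀)) (g t) < ((2 * M * (8 * M) + 2 * M : ℕ) : ℝ≥0∞) := by
    refine ((hH _ _).2).trans_lt ?_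
    have h1 : ((siteGraph M k).comap f).edist (g (entry lab v₀)) (g t) ≤
        ((2 * M * (8 * M) : ℕ) : ℕ∞) := by
      rw [← hP, ← SimpleGraph.Walk.length_map φ P]
      exact SimpleGraph.edist_le (P.map φ)
    have h2 : ((((siteGraph M k).comap f).edist (g (entry lab v₀)) (g t) : ℕ∞) : ℝ≥0∞) ≤
        ((2 * M * (8 * M) : ℕ) : ℝ≥0∞) := by
      have := ENat.toENNReal_le.2 h1
      rwa [ENat.toENNReal_coe] at this
    have h3 : (β : ℝ≥0∞) < ((2 * M : ℕ) : ℝ≥0∞) := by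
      have : β < ((2 * M : ℕ) : ℝ≥0) := by
        rw [← NNReal.coe_lt_coe]; push_cast; exact hβ
      exact_mod_cast ENNReal.coe_lt_coe.2 this
    rw [Nat.cast_add]
    exact ENNReal.add_lt_add_of_le_of_lt (ne_top_of_le_ne_top (ENNReal.natCast_ne_top _) h2) h2 h3
  obtain ⟨Q, hQ⟩ := iInf_lt_iff.1 hup
  have hQ' : (H.walkWeight Q : ℝ) < 2 * M * (8 * M) + 2 * M := by
    have h1 : (H.walkWeight Q : ℝ≥0∞) < (((2 * M * (8 * M) + 2 * M : ℕ) : ℝ≥0) : ℝ≥0∞) := by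
      exact_mod_cast hQ
    have h2 := ENNReal.coe_lt_coe.1 h1
    rw [← NNReal.coe_lt_coe] at h2
    push_cast at h2
    exact h2
  have hM'' : (2 : ℝ) ≤ M := by exact_mod_cast hM
  have key := progress_sub_le_walkWeight (l := 2 * M) hM' hv.lab_mem hH hf hch
    (s := f (g (entry lab v₀))) (by rw [hfs]; rfl) (by rw [hfs]; rfl) Q (by rw [hft]; rfl)
    (by rw [hft]; rfl) .nil (by
      simp only [SimpleGraph.Walk.length_nil]; push_cast; linarith) (i := 0)
    (by rw [hfs]; exact ⟨rfl, .inl (by simp [entry]; omega)⟩)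
  have off : ∀ v, offset lab (entry lab v) = 0 := fun v => by simp [offset, entry]
  rw [hfs, hft] at key
  simp only [progress, off, t] at key
  push_cast at key
  nlinarith

/-- An emulator of stretch below `2 M` has at least one eighth as many edges as there are routes: each
edge has two orientations, and each of the four kinds of charging gives at most one route. -/
theorem card_le_edges [Finite V] {ι : Type*} {s : Finset ι} {M : ℕ} (hM : 2 ≤ M)
    {lab : ι → Bool → ℤ} {v₀ : ι → Junction} (hs : ∀ i ∈ s, IsRoute M k (lab i) (v₀ i))
    (hinj : ∀ i j, lab i = lab j → v₀ i = v₀ j → i = j)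
    {H : WeightedGraph V} {f : V → Site} {g : Site → V} {β : ℝ≥0}
    (hH : H.IsEmulator ((siteGraph M k).comap f) β) (hf : ∀ a, (f a).Valid M k)
    (hg : ∀ u : Site, u.Valid M k → f (g u) = u) (hβ : (β : ℝ) < 2 * M) :
    s.card ≤ 8 * H.graph.edgeSet.ncard := by
  classical
  have := Fintype.ofFinite V
  have hex : ∀ i : s, ∃ e : H.graph.Dart × Fin 4,
      Charged k (lab i) (v₀ i) (f e.1.fst) (f e.1.snd) e.2 := fun i => by
    obtain ⟨a, b, hab, t, h⟩ := exists_charged hM (hs i i.2) hH hf hg hβ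
    exact ⟨(⟨(a, b), hab⟩, t), h⟩
  choose F hF using hex
  have hFinj : Function.Injective F := fun i j hij => by
    have hi := hF i
    rw [hij] at hi
    obtain ⟨h1, h2⟩ := hi.eq (hs i i.2) (hs j j.2) (hF j)
    exact Subtype.ext (hinj _ _ h1 h2)
  have h := Fintype.card_le_of_injective F hFinj
  rw [Fintype.card_coe, Fintype.card_prod, H.graph.dart_card_eq_twice_card_edges,
    Fintype.card_fin] at h
  rw [← SimpleGraph.coe_edgeFinset, Set.ncard_coe_finset]
  omega

end Emulator

/-! ### Choice of the parameters -/

/-- The valid sites, `864 M⁴ κ⁵` in number, are covered by `n` vertices if `n` is large enough. The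
map `f` need not be injective: surplus vertices copy sites. -/
theorem exists_parametrization {n M κ : ℕ} (hM : 1 ≤ M) (hκ : 1 ≤ κ)
    (hn : 864 * M ^ 4 * κ ^ 5 ≤ n) :
    ∃ (f : Fin n → Site) (g : Site → Fin n), (∀ a, (f a).Valid M κ) ∧
      ∀ u : Site, u.Valid M κ → f (g u) = u := by
  let I : ℕ → Finset ℤ := fun N => Finset.Ico 0 (N : ℤ)
  let B : Finset (ℤ × ℤ × ℤ × ℤ × ℤ × Bool × Bool) :=
    I κ ×ˢ I (4 * M) ×ˢ I (3 * M * κ) ×ˢ I (3 * M * κ) ×ˢ I (6 * M * κ ^ 2) ×ˢ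
      Finset.univ ×ˢ Finset.univ
  have hI : ∀ N, (I N).card = N := fun N => by simp [I]
  have hB : B.card = 864 * M ^ 4 * κ ^ 5 := by
    simp only [B, Finset.card_product, hI, Finset.card_univ, Fintype.card_bool]; ring
  have hpos : 0 < B.card := by rw [hB]; positivity
  have : Nonempty B := (Finset.card_pos.1 hpos).to_subtype
  have : Nonempty (Fin n) := ⟨⟨0, by omega⟩⟩
  obtain ⟨e⟩ : Nonempty (B ↪ Fin n) := Function.Embedding.nonempty_of_card_le (by
    rw [Fintype.card_coe, Fintype.card_fin]; omega)
  let toSite : ℤ × ℤ × ℤ × ℤ × ℤ × Bool × Bool → Site :=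
    fun p => ⟨⟨p.2.2.1, p.2.2.2.1, p.2.2.2.2.1, p.2.2.2.2.2.1⟩, p.2.2.2.2.2.2, p.1, p.2.1⟩
  let f : Fin n → Site := fun a => toSite (Function.invFun (α := B) e a).1
  have hmem : ∀ p, p ∈ B ↔ (toSite p).Valid M κ := by
    rintro ⟨d, h, x, y, z, c, s⟩
    simp only [B, I, toSite, Finset.mem_product, Finset.mem_Ico, Finset.mem_univ]
    push_cast
    constructor
    · rintro ⟨⟨h1, h2⟩, ⟨h3, h4⟩, ⟨h5, h6⟩, ⟨h7, h8⟩, ⟨h9, h10⟩, -⟩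
      exact ⟨h1, h2, h3, h4, h5, h6, h7, h8, h9, h10⟩
    · rintro ⟨h1, h2, h3, h4, h5, h6, h7, h8, h9, h10⟩
      exact ⟨⟨h1, h2⟩, ⟨h3, h4⟩, ⟨h5, h6⟩, ⟨h7, h8⟩, ⟨h9, h10⟩, trivial, trivial⟩
  refine ⟨f, Function.invFun f, fun a => (hmem _).1 (Function.invFun (α := B) e a).2, fun u hu => ?_⟩
  refine Function.invFun_eq ?_
  obtain ⟨a, ha⟩ := Function.invFun_surjective e.injective
    ⟨(u.d, u.h, u.hub.x, u.hub.y, u.hub.z, u.hub.c, u.s), (hmem _).2 hu⟩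
  exact ⟨a, by simp only [f, ha, toSite]⟩

/-- Since there are `2 M² κ⁶` routes, each emulator of stretch below `2 M` has many edges. -/
theorem exists_graph_many_edges {n M κ : ℕ} (hM : 2 ≤ M) (hκ : 1 ≤ κ)
    (hn : 864 * M ^ 4 * κ ^ 5 ≤ n) :
    ∃ G : SimpleGraph (Fin n), ∀ (H : WeightedGraph (Fin n)) (β : ℝ≥0), H.IsEmulator G β →
      (β : ℝ) < 2 * M → 2 * M ^ 2 * κ ^ 6 ≤ 8 * H.graph.edgeSet.ncard := by
  obtain ⟨f, g, hf, hg⟩ := exists_parametrization (by omega) hκ hn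
  refine ⟨(siteGraph M κ).comap f, fun H β hH hβ => ?_⟩
  let I : ℕ → Finset ℤ := fun N => Finset.Ico 0 (N : ℤ)
  have hI : ∀ N, (I N).card = N := fun N => by simp [I]
  let R : Finset (ℤ × ℤ × ℤ × ℤ × ℤ) :=
    I κ ×ˢ I κ ×ˢ I (M * κ) ×ˢ I (M * κ) ×ˢ I (2 * κ ^ 2)
  have hR : R.card = 2 * M ^ 2 * κ ^ 6 := by
    simp only [R, Finset.card_product, hI]; ring
  rw [← hR]
  refine card_le_edges (s := R) hM (lab := fun p b => cond b p.2.1 p.1)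
    (v₀ := fun p => ⟨p.2.2.1, p.2.2.2.1, p.2.2.2.2, false⟩) ?_ ?_ hH hf hg hβ
  · rintro ⟨i, j, x, y, z⟩ h
    simp only [R, I, Finset.mem_product, Finset.mem_Ico] at h
    push_cast at h
    obtain ⟨h1, h2, ⟨h5, h6⟩, ⟨h7, h8⟩, h9, h10⟩ := h
    exact ⟨fun b => by cases b <;> assumption, rfl, h5, h6, h7, h8, h9, h10⟩
  · rintro ⟨i, j, x, y, z⟩ ⟨i', j', x', y', z'⟩ h1 h2
    have hi := congrFun h1 false
    have hj := congrFun h1 true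
    simp_all

end ObstacleProduct

theorem theorem2 :
    ∃ G : (n : ℕ) → SimpleGraph (Fin n),
      ∀ C : ℝ, 0 < C → ∃ c : ℝ, 0 < c ∧ ∃ N : ℕ, ∀ n : ℕ, N ≤ n →
        ∀ H : WeightedGraph (Fin n), (H.graph.edgeSet.ncard : ℝ) ≤ C * n →
          ∀ β : ℝ≥0, H.IsEmulator (G n) β →
            c * (n : ℝ) ^ (2 / 29 : ℝ) ≤ (β : ℝ) := by
  -- `q n` is the largest parameter for which the construction fits into `n` vertices
  let q : ℕ → ℕ := fun n => Nat.findGreatest (fun q => 864 * q ^ 145 ≤ n) n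
  have hq : ∀ n, 864 * q n ^ 145 ≤ n := fun n =>
    Nat.findGreatest_spec (P := fun q => 864 * q ^ 145 ≤ n) (Nat.zero_le n)
      (by rw [zero_pow (by norm_num)]; omega)
  have hself : ∀ r : ℕ, r ≤ 864 * r ^ 145 := fun r =>
    (Nat.le_self_pow (by norm_num) r).trans (Nat.le_mul_of_pos_left _ (by norm_num))
  have hle : ∀ n r, 864 * r ^ 145 ≤ n → r ≤ q n := fun n r h =>
    Nat.le_findGreatest ((hself r).trans h) h
  have hG : ∀ n, ∃ G : SimpleGraph (Fin n), 2 ≤ q n → ∀ (H : WeightedGraph (Fin n)) (β : ℝ≥0),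
      H.IsEmulator G β → (β : ℝ) < 2 * (q n : ℝ) ^ 10 →
        2 * q n ^ 146 ≤ 8 * H.graph.edgeSet.ncard := by
    intro n
    by_cases h2 : 2 ≤ q n
    · obtain ⟨G, hG⟩ := ObstacleProduct.exists_graph_many_edges (n := n) (M := q n ^ 10)
        (κ := q n ^ 21) (h2.trans (Nat.le_self_pow (by norm_num) _))
        (Nat.one_le_pow _ _ (by omega)) (by
          rw [mul_assoc, ← pow_mul, ← pow_mul, ← pow_add]; exact hq n)
      refine ⟨G, fun _ H β hH hβ => ?_⟩
      have := hG H β hH (by push_cast; exact hβ)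
      rwa [mul_assoc, ← pow_mul, ← pow_mul, ← pow_add] at this
    · exact ⟨⊥, fun h => absurd h h2⟩
  choose G hG using hG
  refine ⟨G, fun C hC => ?_⟩
  obtain ⟨A, hA, hA0⟩ : ∃ A : ℝ, A = 864 * 2 ^ 145 ∧ 0 < A := ⟨_, rfl, by positivity⟩
  obtain ⟨r, hr⟩ := exists_nat_gt (4 * C * A)
  refine ⟨2 / A ^ (2 / 29 : ℝ), by positivity, 864 * (max r 2) ^ 145, fun n hn H hH β hβ => ?_⟩
  have hqr : max r 2 ≤ q n := hle n _ hn
  have hq2 : 2 ≤ q n := (le_max_right _ _).trans hqr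
  have hqC : 4 * C * A < q n := hr.trans_le (by exact_mod_cast (le_max_left _ _).trans hqr)
  have hq0 : (0 : ℝ) < q n := by positivity
  have hnA : (n : ℝ) ≤ A * (q n : ℝ) ^ 145 := by
    have h1 : n ≤ 864 * (2 * q n) ^ 145 := by
      by_contra! h
      have := hle n _ h.le
      omega
    have h2 : (n : ℝ) ≤ 864 * (2 * (q n : ℝ)) ^ 145 := by exact_mod_cast h1
    rwa [mul_pow, ← mul_assoc, ← hA] at h2
  have hβ2 : 2 * (q n : ℝ) ^ 10 ≤ β := by
    by_contra! h
    have h1 : (2 * (q n : ℝ) ^ 146) ≤ 8 * H.graph.edgeSet.ncard := by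
      exact_mod_cast hG n hq2 H β hβ h
    have h2 : 2 * (q n : ℝ) ^ 146 ≤ (8 * C * A) * (q n : ℝ) ^ 145 := by
      have := mul_le_mul_of_nonneg_left hnA hC.le
      linarith
    rw [pow_succ' (q n : ℝ) 145, ← mul_assoc] at h2
    have := le_of_mul_le_mul_right h2 (by positivity)
    linarith
  have hpow : (n : ℝ) ^ (2 / 29 : ℝ) ≤ A ^ (2 / 29 : ℝ) * (q n : ℝ) ^ 10 := by
    have h1 := Real.rpow_le_rpow (Nat.cast_nonneg n) hnA (by norm_num : (0 : ℝ) ≤ 2 / 29)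
    rwa [Real.mul_rpow hA0.le (by positivity), ← Real.rpow_natCast (q n : ℝ) 145,
      ← Real.rpow_mul hq0.le, show ((145 : ℕ) : ℝ) * (2 / 29) = (10 : ℕ) by norm_num,
      Real.rpow_natCast] at h1
  calc 2 / A ^ (2 / 29 : ℝ) * (n : ℝ) ^ (2 / 29 : ℝ)
      ≤ 2 / A ^ (2 / 29 : ℝ) * (A ^ (2 / 29 : ℝ) * (q n : ℝ) ^ 10) := by gcongr
    _ = 2 * (q n : ℝ) ^ 10 := by
      have : A ^ (2 / 29 : ℝ) ≠ 0 := by positivity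
      field_simp
    _ ≤ β := hβ2
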